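/- Graphs are finite, simple and undirected, $G=(V,E)$ with $N$ nodes, adjacency matrix $\mathbf A$ and node features $\mathbf X\in\mathbb R^{N\times d}$ (row $i$ is the feature vector of node $i$); the input dimension $d\ge 0$ is fixed. **1-WL.** Let $\ell^{(0)}(v)=\mathbf X_{v,:}$ and $\ell^{(t)}(v)=\mathrm{HASH}\big(\ell^{(t-1)}(v),\{\!\{\ell^{(t-1)}(u): u\in N(v)\}\!\}\big)$ with $\mathrm{HASH}$ injective. Write $G\sim_{1\text{-WL}}H$ if for every $t\ge 0$ the multisets of node labels $\ell^{(t)}$ of $G$ and of $H$ coincide. A class $\mathcal F$ of maps from graphs to real vectors is *not more expressive than 1-WL* if $G\sim_{1\text{-WL}}H$ implies $\Phi(G)=\Phi(H)$ for all $\Phi\in\mathcal F$; it is *not less expressive than 1-WL* if for all $G\not\sim_{1\text{-WL}}H$ there is $\Phi\in\mathcal F$ with $\Phi(G)\ne\Phi(H)$; it is *as expressive as 1-WL* if both hold. **Aggregation GSO.** A graph shift operator (GSO) assigns to every graph $G$ a real matrix $\mathbf S=\mathbf S_G\in\mathbb R^{N\times N}$, depending only on $G$ and not on $\mathbf X$.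 It is an *aggregation GSO* if there is one message passing network with finitely many layers $$\mathbf x_i^{(t)}=\phi^{(t)}\Big(\mathbf x_i^{(t-1)},\ \sum_{j\in N(i)}\kappa^{(t)}\big(\mathbf x_j^{(t-1)}\big)\Big),$$ with continuous $\kappa^{(t)},\phi^{(t)}$ between finite-dimensional real spaces, which for every graph $G$ and every signal $\mathbf f\in\mathbb R^{N}$ maps the one-channel input $\mathbf f$ to $\mathbf S_G\mathbf f$. **Polynomial spectral GNNs.** For a function $\rho:\mathbb R\to\mathbb R$ applied entrywise and a GSO $\mathbf S$, let $\mathcal F_{\mathrm{spec}}^{\rho}(\mathbf S)$ be the class of maps $(G,\mathbf X)\mapsto\sum_{i}\mathbf X^{(L)}_{i,:}$ (sum pooling), where $\mathbf X^{(0)}=\mathbf X$, the number of layers $L\ge 1$ and the widths are arbitrary, and $$\mathbf X^{(t)}=\rho\Big(\sum_{k=0}^{K}\mathbf S^k\,\mathbf X^{(t-1)}\,(\mathbf C^{(t)}_k)^{\top}+\mathbf 1\,(\mathbf b^{(t)})^{\top}\Big),\qquad t=1,\dots,L,$$ with arbitrary degree $K\ge 0$, real weight matrices $\mathbf C_k^{(t)}$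 and bias vectors $\mathbf b^{(t)}$. Let $\mathcal F_{\mathrm{spec},K}^{\rho}(\mathbf S)$ be the subclass with $K$ fixed. **Proposition.** 1. If $\mathbf S$ is an aggregation GSO, then for every activation $\rho$ the class $\mathcal F_{\mathrm{spec}}^{\rho}(\mathbf S)$ is not more expressive than 1-WL. 2. If $\mathbf S=\mathbf A$ and $\rho=\mathrm{ReLU}$, then $\mathcal F_{\mathrm{spec}}^{\rho}(\mathbf A)$ is as expressive as 1-WL; so is $\mathcal F_{\mathrm{spec},K}^{\rho}(\mathbf A)$ for every fixed $K\ge 1$. -/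

import Mathlib

universe u

/-- A finite simple undirected graph whose nodes carry feature vectors in `ℝ^d`
(the rows of the feature matrix `X`).  `d = 0` is a graph without features. -/
structure FeatGraph (d : ℕ) : Type (u + 1) where
  V : Type u
  [fintypeV : Fintype V]
  graph : SimpleGraph V
  X : Matrix V (Fin d) ℝ

attribute [instance] FeatGraph.fintypeV

/-! ### The 1-dimensional Weisfeiler-Leman test -/

/-- Colors of the 1-WL test after `t` rounds, for initial labels in `α`. A color of round `t + 1`
is the pair (old color, multiset of old colors of the neighbors) itself, so the `HASH` of the
test is the identity, which is injective. -/
def WLColor (α : Type) : ℕ → Type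
  | 0 => α
  | t + 1 => WLColor α t × Multiset (WLColor α t)

open Classical in
/-- Color refinement. The initial label of a node is its feature vector. -/
noncomputable def FeatGraph.wlColor {d : ℕ} (G : FeatGraph.{u} d) :
    (t : ℕ) → G.V → WLColor (Fin d → ℝ) t
  | 0, v => G.X v
  | t + 1, v => (G.wlColor t v, (G.graph.neighborFinset v).val.map (G.wlColor t))

/-- The multiset of all node colors after `t` rounds. -/
noncomputable def FeatGraph.wlHistogram {d : ℕ} (G : FeatGraph.{u} d) (t : ℕ) :
    Multiset (WLColor (Fin d → ℝ) t) :=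
  (Finset.univ : Finset G.V).val.map (G.wlColor t)

/-- Two graphs are 1-WL equivalent when their multisets of colors agree in every round. -/
def wlSetoid (d : ℕ) : Setoid (FeatGraph.{u} d) where
  r G H := ∀ t : ℕ, G.wlHistogram t = H.wlHistogram t
  iseqv :=
    { refl := fun _ _ => rfl
      symm := fun h t => (h t).symm
      trans := fun h k t => (h t).trans (k t) }

/-! ### Comparing the expressive power of a class of GNNs with a test -/

/-- A class of graph-level models on graphs with features in `ℝ^d`: for every output dimension
`m`, a set of maps from graphs to `ℝ^m`. -/
abbrev GNNClass (d : ℕ) : Type (u + 1) := (m : ℕ) → Set (FeatGraph.{u} d → (Fin m → ℝ))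

/-- The test distinguishes all the graphs that the class distinguishes. -/
def NotMoreExpressive {d : ℕ} (F : GNNClass.{u} d) (T : Setoid (FeatGraph.{u} d)) : Prop :=
  ∀ G H : FeatGraph.{u} d, T.r G H → ∀ m : ℕ, ∀ Φ ∈ F m, Φ G = Φ H

/-- The class distinguishes all the graphs that the test distinguishes. -/
def NotLessExpressive {d : ℕ} (F : GNNClass.{u} d) (T : Setoid (FeatGraph.{u} d)) : Prop :=
  ∀ G H : FeatGraph.{u} d, ¬ T.r G H → ∃ m : ℕ, ∃ Φ ∈ F m, Φ G ≠ Φ H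

def AsExpressive {d : ℕ} (F : GNNClass.{u} d) (T : Setoid (FeatGraph.{u} d)) : Prop :=
  NotLessExpressive F T ∧ NotMoreExpressive F T

/-! ### Message passing networks with sum aggregation -/

/-- A layer `x_i ↦ φ (x_i, ∑_{j ∈ N(i)} κ (x_j))` from `a` to `b` channels with continuous
`κ : ℝ^a → ℝ^m` and `φ : ℝ^a × ℝ^m → ℝ^b`. -/
structure MPNNLayer (a b : ℕ) : Type where
  m : ℕ
  κ : (Fin a → ℝ) → (Fin m → ℝ)
  φ : (Fin a → ℝ) × (Fin m → ℝ) → (Fin b → ℝ)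
  continuous_κ : Continuous κ
  continuous_φ : Continuous φ

open Classical in
noncomputable def MPNNLayer.eval {a b : ℕ} (l : MPNNLayer a b) {V : Type u} [Fintype V]
    (G : SimpleGraph V) (X : Matrix V (Fin a) ℝ) : Matrix V (Fin b) ℝ :=
  Matrix.of fun i => l.φ (X i, ∑ j ∈ G.neighborFinset i, l.κ (X j))

/-- A finite nonempty composition of layers. -/
inductive MPNN : ℕ → ℕ → Type
  | single {a b : ℕ} (l : MPNNLayer a b) : MPNN a b
  | cons {a b c : ℕ} (l : MPNNLayer a b) (M : MPNN b c) : MPNN a c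

/-- The node features after the last layer. -/
noncomputable def MPNN.eval {a b : ℕ} (M : MPNN a b) {V : Type u} [Fintype V]
    (G : SimpleGraph V) (X : Matrix V (Fin a) ℝ) : Matrix V (Fin b) ℝ :=
  match M with
  | .single l => l.eval G X
  | .cons l M => M.eval G (l.eval G X)

/-! ### Graph shift operators -/

/-- A graph shift operator assigns to every finite graph with node set `V` a real
`V × V` matrix. -/
def GSO : Type (u + 1) :=
  (V : Type u) → [Fintype V] → SimpleGraph V → Matrix V V ℝ

open Classical in
/-- The adjacency matrix as a graph shift operator. -/
noncomputable def adjGSO : GSO.{u} := fun _ _ G => G.adjMatrix ℝ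

/-- `S` is an aggregation graph shift operator: a single message passing network with sum
aggregation and finitely many layers, applied to the one-channel signal `f`, returns `S f`, for
all graphs and all signals. -/
def IsAggregationGSO (S : GSO.{u}) : Prop :=
  ∃ M : MPNN 1 1, ∀ (V : Type u) [Fintype V] (G : SimpleGraph V) (f : V → ℝ) (i : V),
    M.eval G (Matrix.of fun v _ => f v) i 0 = (S V G).mulVec f i

/-! ### Spectral GNNs with polynomial filters -/

/-- The weights of a layer from `a` to `b` channels, with a matrix-valued polynomial filter of
degree at most `K`: coefficient matrices `C_0, …, C_K` and a bias vector. -/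
structure SpecLayer (K a b : ℕ) : Type where
  C : Fin (K + 1) → Matrix (Fin b) (Fin a) ℝ
  bias : Fin b → ℝ

open Classical in
/-- `X ↦ ρ (∑_{k=0}^K S^k X C_kᵀ + bias)`, where `ρ` acts entrywise and the bias vector is added
to every row. -/
noncomputable def SpecLayer.eval {K a b : ℕ} (l : SpecLayer K a b) (ρ : ℝ → ℝ)
    {V : Type u} [Fintype V] (S : Matrix V V ℝ) (X : Matrix V (Fin a) ℝ) :
    Matrix V (Fin b) ℝ :=
  Matrix.of fun i j =>
    ρ ((∑ k : Fin (K + 1), S ^ (k : ℕ) * X * (l.C k).transpose) i j + l.bias j)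

/-- A finite nonempty composition of layers. -/
inductive SpecGNN (K : ℕ) : ℕ → ℕ → Type
  | single {a b : ℕ} (l : SpecLayer K a b) : SpecGNN K a b
  | cons {a b c : ℕ} (l : SpecLayer K a b) (N : SpecGNN K b c) : SpecGNN K a c

/-- The node features after the last layer. -/
noncomputable def SpecGNN.eval {K a b : ℕ} (N : SpecGNN K a b) (ρ : ℝ → ℝ)
    {V : Type u} [Fintype V] (S : Matrix V V ℝ) (X : Matrix V (Fin a) ℝ) :
    Matrix V (Fin b) ℝ :=
  match N with
  | .single l => l.eval ρ S X
  | .cons l N => N.eval ρ S (l.eval ρ S X)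

/-- The graph-level output: the sum over the nodes of the final node features. -/
noncomputable def SpecGNN.output {K d m : ℕ} (N : SpecGNN K d m) (ρ : ℝ → ℝ) (S : GSO.{u})
    (G : FeatGraph.{u} d) : Fin m → ℝ :=
  fun c => ∑ v : G.V, N.eval ρ (S G.V G.graph) G.X v c

/-- Polynomial spectral GNNs with activation `ρ`, graph shift operator `S` and sum pooling, all
of whose filters have degree at most `K`. -/
def specClassDeg (d : ℕ) (ρ : ℝ → ℝ) (S : GSO.{u}) (K : ℕ) : GNNClass.{u} d :=
  fun m => Set.range fun N : SpecGNN K d m => N.output ρ S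

/-- Polynomial spectral GNNs with activation `ρ`, graph shift operator `S` and sum pooling, with
no bound on the degrees. Zero coefficient matrices are allowed, so a common `K` for all the layers
of a network is no restriction. -/
def specClass (d : ℕ) (ρ : ℝ → ℝ) (S : GSO.{u}) : GNNClass.{u} d :=
  fun m => ⋃ K : ℕ, specClassDeg d ρ S K m

/-- The activation `x ↦ max x 0`. -/
noncomputable def relu (x : ℝ) : ℝ := max x 0

/-! ### Node functions determined by the colors of the 1-WL test -/

/-! Upper bound: node functions that factor through the color of some round, uniformly over all
graphs, are closed under pairing, postcomposition and neighbor sums, hence under message passing. An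
aggregation GSO acts on signals by message passing, so its powers and every spectral layer preserve
this property; sum pooling then sees only the color histogram.

Lower bound: finitely many graphs show finitely many colors per round. By induction on the round
(`exists_color_encoding`), networks output any prescribed shifted ReLUs of a real code that is
injective on these colors. Suitable shifts span all functions on a finite set, so the next layer can
form `g` of the old color plus the neighbor sum of `h` for any `g` and `h`; a generic choice is
injective on the new colors (`Set.Finite.exists_injOn_add_sum`). Reading out the indicator of one
color and pooling counts the nodes of that color. -/

/-- The node function `Φ` is determined by the color of the node after `t` rounds. -/
def FactorsThroughColor {d : ℕ} {β : Type*} (Φ : ∀ G : FeatGraph.{u} d, G.V → β) (t : ℕ) : Prop :=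
  ∃ F : WLColor (Fin d → ℝ) t → β, ∀ G v, Φ G v = F (G.wlColor t v)

/-- The node function `Φ` is determined by the color of the node after some number of rounds. -/
def IsColorInvariant {d : ℕ} {β : Type*} (Φ : ∀ G : FeatGraph.{u} d, G.V → β) : Prop :=
  ∃ t, FactorsThroughColor Φ t

section Invariant

variable {d : ℕ} {β γ : Type*}

theorem FactorsThroughColor.mono {Φ : ∀ G : FeatGraph.{u} d, G.V → β} {s t : ℕ}
    (h : FactorsThroughColor Φ s) (hst : s ≤ t) : FactorsThroughColor Φ t := by
  induction t, hst using Nat.le_induction with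
  | base => exact h
  | succ t _ ih =>
    obtain ⟨F, hF⟩ := ih
    exact ⟨fun c => F c.1, hF⟩

theorem isColorInvariant_features : IsColorInvariant fun G : FeatGraph.{u} d => (G.X : G.V → _) :=
  ⟨0, fun c => c, fun _ _ => rfl⟩

theorem IsColorInvariant.pi {ι : Type*} [Fintype ι] {β : ι → Type*}
    {Φ : ∀ G : FeatGraph.{u} d, G.V → ∀ i, β i}
    (h : ∀ i, IsColorInvariant fun G v => Φ G v i) : IsColorInvariant Φ := by
  choose t ht using h
  choose F hF using fun i => (ht i).mono (Finset.le_sup (f := t) (Finset.mem_univ i))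
  exact ⟨_, fun c i => F i c, fun G v => funext fun i => hF i G v⟩

theorem IsColorInvariant.comp {Φ : ∀ G : FeatGraph.{u} d, G.V → β} (h : IsColorInvariant Φ)
    (f : β → γ) : IsColorInvariant fun G v => f (Φ G v) := by
  obtain ⟨t, F, hF⟩ := h
  exact ⟨t, fun c => f (F c), fun G v => congrArg f (hF G v)⟩

theorem IsColorInvariant.prodMk {Φ : ∀ G : FeatGraph.{u} d, G.V → β}
    {Ψ : ∀ G : FeatGraph.{u} d, G.V → γ} (h : IsColorInvariant Φ) (h' : IsColorInvariant Ψ) :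
    IsColorInvariant fun G v => (Φ G v, Ψ G v) := by
  obtain ⟨s, hs⟩ := h
  obtain ⟨t, ht⟩ := h'
  obtain ⟨F, hF⟩ := hs.mono (le_max_left s t)
  obtain ⟨F', hF'⟩ := ht.mono (le_max_right s t)
  exact ⟨_, fun c => (F c, F' c), fun G v => Prod.ext (hF G v) (hF' G v)⟩

-- The neighbors' colors are the second component of the next color, so aggregation costs one round.
open Classical in
theorem IsColorInvariant.sum_neighborFinset [AddCommMonoid β]
    {Φ : ∀ G : FeatGraph.{u} d, G.V → β} (h : IsColorInvariant Φ) :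
    IsColorInvariant fun G v => ∑ w ∈ G.graph.neighborFinset v, Φ G w := by
  obtain ⟨t, F, hF⟩ := h
  refine ⟨t + 1, fun c => (c.2.map F).sum, fun G v => ?_⟩
  simp only [hF, FeatGraph.wlColor, Multiset.map_map]
  rfl

theorem MPNNLayer.isColorInvariant_eval {a b : ℕ} (l : MPNNLayer a b)
    {Φ : ∀ G : FeatGraph.{u} d, Matrix G.V (Fin a) ℝ}
    (h : IsColorInvariant fun G => (Φ G : G.V → _)) :
    IsColorInvariant fun G => (l.eval G.graph (Φ G) : G.V → _) :=
  (h.prodMk (h.comp l.κ).sum_neighborFinset).comp l.φ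

theorem MPNN.isColorInvariant_eval {a b : ℕ} (M : MPNN a b)
    {Φ : ∀ G : FeatGraph.{u} d, Matrix G.V (Fin a) ℝ}
    (h : IsColorInvariant fun G => (Φ G : G.V → _)) :
    IsColorInvariant fun G => (M.eval G.graph (Φ G) : G.V → _) := by
  induction M with
  | single l => exact l.isColorInvariant_eval h
  | cons l M ih => exact ih (l.isColorInvariant_eval h)

/-- Only the action of `S` on signals is controlled, not its entries; the defining network is run on
`f` in place of the node features. -/
theorem IsAggregationGSO.isColorInvariant_mulVec {S : GSO.{u}} (hS : IsAggregationGSO S)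
    {f : ∀ G : FeatGraph.{u} d, G.V → ℝ} (h : IsColorInvariant f) :
    IsColorInvariant fun G => (S G.V G.graph).mulVec (f G) := by
  obtain ⟨M, hM⟩ := hS
  have hf : IsColorInvariant fun G : FeatGraph.{u} d =>
      (Matrix.of (fun v (_ : Fin 1) => f G v) : G.V → _) := h.comp fun x _ => x
  convert (M.isColorInvariant_eval hf).comp fun x => x 0 using 3 with G v
  exact (hM G.V G.graph (f G) v).symm

open Classical in
theorem IsAggregationGSO.isColorInvariant_pow_mulVec {S : GSO.{u}} (hS : IsAggregationGSO S)
    {f : ∀ G : FeatGraph.{u} d, G.V → ℝ} (h : IsColorInvariant f) (k : ℕ) :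
    IsColorInvariant fun G => (S G.V G.graph ^ k).mulVec (f G) := by
  induction k with
  | zero => simpa using h
  | succ k ih =>
    simpa only [pow_succ', ← Matrix.mulVec_mulVec] using hS.isColorInvariant_mulVec ih

open Classical in
theorem SpecLayer.eval_apply {K a b : ℕ} (l : SpecLayer K a b) (ρ : ℝ → ℝ) {V : Type*}
    [Fintype V] (S : Matrix V V ℝ) (X : Matrix V (Fin a) ℝ) (i : V) (j : Fin b) :
    l.eval ρ S X i j =
      ρ (∑ k : Fin (K + 1), ∑ c, l.C k j c * ((S ^ (k : ℕ)).mulVec fun v => X v c) i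
        + l.bias j) := by
  simp only [SpecLayer.eval, Matrix.of_apply, Matrix.sum_apply]
  congr 2
  refine Finset.sum_congr rfl fun k _ => ?_
  rw [Matrix.mul_apply]
  exact Finset.sum_congr rfl fun c _ => mul_comm _ _

theorem IsAggregationGSO.isColorInvariant_layer {S : GSO.{u}} (hS : IsAggregationGSO S)
    {K a b : ℕ} (l : SpecLayer K a b) (ρ : ℝ → ℝ)
    {Φ : ∀ G : FeatGraph.{u} d, Matrix G.V (Fin a) ℝ}
    (h : IsColorInvariant fun G => (Φ G : G.V → _)) :
    IsColorInvariant fun G => (l.eval ρ (S G.V G.graph) (Φ G) : G.V → _) := by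
  classical
  have hpow : IsColorInvariant fun (G : FeatGraph.{u} d) v (k : Fin (K + 1)) (c : Fin a) =>
      ((S G.V G.graph ^ (k : ℕ)).mulVec fun w => Φ G w c) v :=
    .pi fun k => .pi fun c => hS.isColorInvariant_pow_mulVec (h.comp fun x => x c) k
  obtain ⟨t, F, hF⟩ := hpow.comp fun y j => ρ (∑ k, ∑ c, l.C k j c * y k c + l.bias j)
  exact ⟨t, F, fun G v => (funext fun j => l.eval_apply ρ _ _ v j).trans (hF G v)⟩

theorem IsAggregationGSO.isColorInvariant_eval {S : GSO.{u}} (hS : IsAggregationGSO S)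
    {K a b : ℕ} (N : SpecGNN K a b) (ρ : ℝ → ℝ)
    {Φ : ∀ G : FeatGraph.{u} d, Matrix G.V (Fin a) ℝ}
    (h : IsColorInvariant fun G => (Φ G : G.V → _)) :
    IsColorInvariant fun G => (N.eval ρ (S G.V G.graph) (Φ G) : G.V → _) := by
  induction N with
  | single l => exact hS.isColorInvariant_layer l ρ h
  | cons l N ih => exact ih (hS.isColorInvariant_layer l ρ h)

theorem IsColorInvariant.sum_eq [AddCommMonoid β] {Φ : ∀ G : FeatGraph.{u} d, G.V → β}
    (h : IsColorInvariant Φ) {G H : FeatGraph.{u} d} (hGH : (wlSetoid d).r G H) :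
    ∑ v, Φ G v = ∑ v, Φ H v := by
  obtain ⟨t, F, hF⟩ := h
  have key : ∀ G : FeatGraph.{u} d, ∑ v, Φ G v = ((G.wlHistogram t).map F).sum := fun G => by
    simp only [hF, FeatGraph.wlHistogram, Multiset.map_map]
    rfl
  rw [key, key, hGH t]

theorem IsAggregationGSO.notMoreExpressive {S : GSO.{u}} (hS : IsAggregationGSO S) (ρ : ℝ → ℝ)
    (K : ℕ) : NotMoreExpressive (specClassDeg d ρ S K) (wlSetoid d) := by
  rintro G H hGH m _ ⟨N, rfl⟩
  ext c
  exact ((hS.isColorInvariant_eval N ρ isColorInvariant_features).comp fun x => x c).sum_eq hGH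

end Invariant

theorem isAggregationGSO_adjGSO : IsAggregationGSO adjGSO.{u} := by
  classical
  refine ⟨.single ⟨1, id, Prod.snd, continuous_id, continuous_snd⟩, fun V _ G f i => ?_⟩
  rw [adjGSO, SimpleGraph.adjMatrix_mulVec_apply]
  exact Finset.sum_apply (0 : Fin 1) _ fun v (_ : Fin 1) => f v

/-! ### Encoding of finite sets by linear maps and ReLU units -/

/-- On a finite set of reals, every function is a linear combination of finitely many shifted
ReLU functions. -/
theorem exists_sum_relu_eqOn (R : Finset ℝ) :
    ∃ (n : ℕ) (θ : Fin n → ℝ), ∀ g : ℝ → ℝ, ∃ c : Fin n → ℝ,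
      ∀ r ∈ R, ∑ j, c j * relu (r - θ j) = g r := by
  induction R using Finset.induction_on_max with
  | empty => exact ⟨0, Fin.elim0, fun _ => ⟨Fin.elim0, by simp⟩⟩
  | insert a s has ih =>
    obtain ⟨n, θ, h⟩ := ih
    -- A unit with threshold `b` vanishes on `s` and is positive at `a`, so it corrects the value at
    -- `a` alone.
    obtain ⟨b, hba, hb⟩ : ∃ b < a, ∀ x ∈ s, x ≤ b := by
      rcases s.eq_empty_or_nonempty with rfl | hs
      · exact ⟨a - 1, by linarith, by simp⟩
      · exact ⟨s.max' hs, has _ (s.max'_mem hs), fun x hx => s.le_max' x hx⟩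
    refine ⟨n + 1, Fin.cons b θ, fun g => ?_⟩
    obtain ⟨c, hc⟩ := h g
    refine ⟨Fin.cons ((g a - ∑ j, c j * relu (a - θ j)) / (a - b)) c, fun r hr => ?_⟩
    simp only [Fin.sum_univ_succ, Fin.cons_zero, Fin.cons_succ]
    rcases Finset.mem_insert.1 hr with rfl | hr
    · have hpos : 0 < r - b := sub_pos.2 hba
      rw [relu, max_eq_left hpos.le, div_mul_cancel₀ _ hpos.ne', sub_add_cancel]
    · rw [hc r hr, relu, max_eq_right (sub_nonpos.2 (hb r hr)), mul_zero, zero_add]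

/-- The shifts are chosen before `g`, so one bank of units serves several target functions. -/
theorem Set.InjOn.exists_sum_relu_eqOn {α : Type*} {s : Set α} (hs : s.Finite) {code : α → ℝ}
    (hcode : s.InjOn code) :
    ∃ (n : ℕ) (θ : Fin n → ℝ), ∀ g : α → ℝ, ∃ c : Fin n → ℝ,
      ∀ a ∈ s, ∑ j, c j * relu (code a - θ j) = g a := by
  obtain ⟨n, θ, h⟩ := _root_.exists_sum_relu_eqOn (hs.image code).toFinset
  refine ⟨n, θ, fun g => ?_⟩
  obtain ⟨c, hc⟩ := h (Function.extend (s.domRestrict code) (s.domRestrict g) 0)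
  refine ⟨c, fun a ha => (hc _ (by simpa using ⟨a, ha, rfl⟩)).trans ?_⟩
  exact hcode.injective.extend_apply _ _ (⟨a, ha⟩ : s)

/-- Over an infinite field, some linear form is injective on a given finite set of vectors. -/
theorem Set.Finite.exists_dual_injOn {𝕜 E : Type*} [Field 𝕜] [Infinite 𝕜] [AddCommGroup E]
    [Module 𝕜 E] {s : Set E} (hs : s.Finite) : ∃ f : Module.Dual 𝕜 E, s.InjOn f := by
  have := hs.to_subtype
  -- Injectivity means that `f` kills none of the finitely many nonzero differences.
  obtain ⟨f, hf⟩ := Module.exists_dual_forall_apply_ne_zero (K := 𝕜)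
    (fun p : {p : s × s // p.1 ≠ p.2} => (p.1.1 : E) - p.1.2)
    fun p => sub_ne_zero.2 fun h => p.2 (Subtype.ext h)
  refine ⟨f, fun x hx y hy hxy => ?_⟩
  by_contra hne
  refine hf ⟨(⟨x, hx⟩, ⟨y, hy⟩), fun h => hne (congrArg Subtype.val h)⟩ ?_
  rw [map_sub, hxy, sub_self]

/-- The coefficient at `a` is the multiplicity of `a`. -/
theorem Multiset.sum_map_single_injective (α : Type*) :
    Function.Injective fun M : Multiset α => (M.map fun a => Finsupp.single a (1 : ℝ)).sum := by
  classical
  have key : ∀ (M : Multiset α) (a : α),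
      (M.map fun a => Finsupp.single a (1 : ℝ)).sum a = M.count a := fun M a => by
    induction M using Multiset.induction_on with
    | empty => simp
    | cons b M ih =>
      rw [Multiset.map_cons, Multiset.sum_cons, Finsupp.add_apply, ih, Multiset.count_cons,
        Finsupp.single_apply, add_comm]
      simp [eq_comm]
  refine fun M M' h => Multiset.ext.2 fun a => ?_
  have h' := congrArg (fun f : α →₀ ℝ => f a) h
  simpa only [key, Nat.cast_inj] using h'

/-- On a finite set of pairs of an element and a multiset, some function
`(c, M) ↦ g c + ∑ a ∈ M, h a` is injective. -/
theorem Set.Finite.exists_injOn_add_sum {α : Type*} {s : Set (α × Multiset α)} (hs : s.Finite) :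
    ∃ g h : α → ℝ, s.InjOn fun p => g p.1 + (p.2.map h).sum := by
  -- `z` embeds the pairs into a vector space; a linear form injective on the finite image gives `g`
  -- and `h` by its values on basis vectors.
  let z : α × Multiset α → (α →₀ ℝ) × (α →₀ ℝ) := fun p =>
    (Finsupp.single p.1 1, (p.2.map fun a => Finsupp.single a (1 : ℝ)).sum)
  have hz : Function.Injective z := fun p q hpq => by
    obtain ⟨h₁, h₂⟩ := Prod.ext_iff.1 hpq
    exact Prod.ext (Finsupp.single_left_injective one_ne_zero h₁)
      (Multiset.sum_map_single_injective α h₂)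
  obtain ⟨f, hf⟩ := (hs.image z).exists_dual_injOn (𝕜 := ℝ)
  refine ⟨fun a => f (Finsupp.single a 1, 0), fun a => f (0, Finsupp.single a 1),
    fun p hp q hq hpq => ?_⟩
  have key : ∀ p : α × Multiset α, f (z p) =
      f (Finsupp.single p.1 1, 0) + (p.2.map fun a => f (0, Finsupp.single a 1)).sum := fun p => by
    have h := map_multiset_sum (f ∘ₗ LinearMap.inr ℝ (α →₀ ℝ) (α →₀ ℝ))
      (p.2.map fun a => Finsupp.single a (1 : ℝ))
    rw [Multiset.map_map] at h
    change _ = _ + (p.2.map ((f ∘ₗ LinearMap.inr ℝ (α →₀ ℝ) (α →₀ ℝ)) ∘ _)).sum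
    erw [← h]
    rw [LinearMap.comp_apply, LinearMap.inr_apply, ← map_add]
    simp [z]
  exact hz (hf ⟨p, hp, rfl⟩ ⟨q, hq, rfl⟩ (by rw [key, key]; exact hpq))

/-! ### Spectral networks that simulate color refinement -/

/-- Append a layer at the end of a network. -/
def SpecGNN.snoc {K a b c : ℕ} (N : SpecGNN K a b) (l : SpecLayer K b c) : SpecGNN K a c :=
  match N with
  | .single l' => .cons l' (.single l)
  | .cons l' N => .cons l' (N.snoc l)

theorem SpecGNN.eval_snoc {K a b c : ℕ} (N : SpecGNN K a b) (l : SpecLayer K b c) (ρ : ℝ → ℝ)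
    {V : Type*} [Fintype V] (S : Matrix V V ℝ) (X : Matrix V (Fin a) ℝ) :
    (N.snoc l).eval ρ S X = l.eval ρ S (N.eval ρ S X) := by
  induction N with
  | single l' => rfl
  | cons l' N ih => exact ih l _

/-- The layer with the filter `X Pᵀ + S X Qᵀ` of degree one. -/
def SpecLayer.ofLinear (K : ℕ) {a b : ℕ} (P Q : Matrix (Fin b) (Fin a) ℝ) (β : Fin b → ℝ) :
    SpecLayer K a b where
  C k := if (k : ℕ) = 0 then P else if (k : ℕ) = 1 then Q else 0
  bias := β

open Classical in
theorem SpecLayer.eval_ofLinear {K a b : ℕ} (hK : 1 ≤ K) (P Q : Matrix (Fin b) (Fin a) ℝ)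
    (β : Fin b → ℝ) (ρ : ℝ → ℝ) {V : Type u} [Fintype V] (G : SimpleGraph V)
    (X : Matrix V (Fin a) ℝ) (v : V) (j : Fin b) :
    (SpecLayer.ofLinear K P Q β).eval ρ (adjGSO V G) X v j =
      ρ (∑ c, P j c * X v c + ∑ w ∈ G.neighborFinset v, ∑ c, Q j c * X w c + β j) := by
  obtain ⟨K, rfl⟩ := Nat.exists_eq_add_of_le' hK
  rw [SpecLayer.eval_apply, Fin.sum_univ_succ, Fin.sum_univ_succ,
    Finset.sum_comm (s := G.neighborFinset v)]
  simp [SpecLayer.ofLinear, adjGSO, SimpleGraph.adjMatrix_mulVec_apply, Finset.mul_sum, add_assoc]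

/-- On finitely many graphs, networks of any fixed positive degree compute shifted ReLUs of an
encoding of the colors after `t` rounds of the 1-WL test. -/
theorem exists_color_encoding {d K : ℕ} (hK : 1 ≤ K) {ι : Type*} [Finite ι]
    (𝒢 : ι → FeatGraph.{u} d) (t : ℕ) :
    ∃ code : WLColor (Fin d → ℝ) t → ℝ,
      Set.InjOn code (Set.range fun p : Σ i, (𝒢 i).V => (𝒢 p.1).wlColor t p.2) ∧
      ∀ (n : ℕ) (θ : Fin n → ℝ), ∃ N : SpecGNN K d n, ∀ i v j,
        N.eval relu (adjGSO _ (𝒢 i).graph) (𝒢 i).X v j =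
          relu (code ((𝒢 i).wlColor t v) - θ j) := by
  induction t with
  | zero =>
    obtain ⟨f, hf⟩ := (Set.finite_range
      fun p : Σ i, (𝒢 i).V => (𝒢 p.1).X p.2).exists_dual_injOn (𝕜 := ℝ)
    refine ⟨f, hf, fun n θ => ⟨.single (.ofLinear K
      (.of fun _ c => f fun j => if c = j then 1 else 0) 0 fun j => -θ j), fun i v j => ?_⟩⟩
    rw [SpecGNN.eval, SpecLayer.eval_ofLinear hK]
    change _ = relu (f ((𝒢 i).X v) - θ j)
    rw [LinearMap.pi_apply_eq_sum_univ]
    simp [mul_comm, sub_eq_add_neg]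
  | succ t ih =>
    obtain ⟨code, hcode, hN⟩ := ih
    obtain ⟨g, h, hgh⟩ := (Set.finite_range
      fun p : Σ i, (𝒢 i).V => (𝒢 p.1).wlColor (t + 1) p.2).exists_injOn_add_sum
    obtain ⟨n, θ, hθ⟩ := hcode.exists_sum_relu_eqOn (Set.finite_range _)
    obtain ⟨p, hp⟩ := hθ g
    obtain ⟨q, hq⟩ := hθ h
    obtain ⟨N, hN⟩ := hN n θ
    replace hp := fun i v => hp ((𝒢 i).wlColor t v) ⟨⟨i, v⟩, rfl⟩
    replace hq := fun i v => hq ((𝒢 i).wlColor t v) ⟨⟨i, v⟩, rfl⟩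
    -- The readouts `p` of `g` and `q` of `h` become the degree-zero and degree-one coefficients of
    -- the new layer, with the shift as bias.
    refine ⟨fun c => g c.1 + (c.2.map h).sum, hgh, fun m θ' => ⟨N.snoc
      (.ofLinear K (.of fun _ => p) (.of fun _ => q) fun j => -θ' j), fun i v j => ?_⟩⟩
    rw [SpecGNN.eval_snoc, SpecLayer.eval_ofLinear hK]
    simp only [hN, Matrix.of_apply, hp, hq, FeatGraph.wlColor, Multiset.map_map]
    rw [sub_eq_add_neg]
    rfl

/-- On finitely many graphs, networks of any fixed positive degree compute the sum over the nodes
of any nonnegative function of the color after `t` rounds of the 1-WL test. -/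
theorem exists_output_eq_sum_color {d K : ℕ} (hK : 1 ≤ K) {ι : Type*} [Finite ι]
    (𝒢 : ι → FeatGraph.{u} d) (t : ℕ) {g : WLColor (Fin d → ℝ) t → ℝ} (hg : 0 ≤ g) :
    ∃ N : SpecGNN K d 1, ∀ i, N.output relu adjGSO (𝒢 i) 0 = ∑ v, g ((𝒢 i).wlColor t v) := by
  obtain ⟨code, hcode, hN⟩ := exists_color_encoding hK 𝒢 t
  obtain ⟨n, θ, hθ⟩ := hcode.exists_sum_relu_eqOn (Set.finite_range _)
  obtain ⟨p, hp⟩ := hθ g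
  obtain ⟨N, hN⟩ := hN n θ
  -- The last ReLU is harmless because `g` is nonnegative.
  refine ⟨N.snoc (.ofLinear K (.of fun _ => p) 0 0), fun i => Finset.sum_congr rfl fun v _ => ?_⟩
  rw [SpecGNN.eval_snoc, SpecLayer.eval_ofLinear hK]
  simp only [hN, Matrix.of_apply, hp _ ⟨⟨i, v⟩, rfl⟩]
  simpa [relu] using hg ((𝒢 i).wlColor t v)

theorem notLessExpressive_specClassDeg_relu_adjGSO (d : ℕ) {K : ℕ} (hK : 1 ≤ K) :
    NotLessExpressive (specClassDeg d relu adjGSO.{u} K) (wlSetoid d) := by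
  classical
  intro G H hGH
  by_contra! hcon
  refine hGH fun t => Multiset.ext.2 fun c => ?_
  -- Indexing by `Bool` yields one network valid on both graphs.
  obtain ⟨N, hN⟩ := exists_output_eq_sum_color hK (fun b : Bool => if b then G else H) t
    (g := Pi.single c 1) (Pi.single_nonneg.2 zero_le_one)
  have hcount : ∀ G : FeatGraph.{u} d,
      ∑ v, (Pi.single c 1 : _ → ℝ) (G.wlColor t v) = (G.wlHistogram t).count c := fun G => by
    simp [FeatGraph.wlHistogram, Multiset.count_map, Pi.single_apply, Finset.card_def, eq_comm]
  have hG := hN true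
  have hH := hN false
  simp only [if_true, Bool.false_eq_true, if_false, hcount] at hG hH
  rw [← Nat.cast_inj (R := ℝ), ← hG, ← hH]
  exact congrFun (hcon 1 _ ⟨N, rfl⟩) 0

theorem specClassDeg_subset_specClass (d : ℕ) (ρ : ℝ → ℝ) (S : GSO.{u}) (K m : ℕ) :
    specClassDeg d ρ S K m ⊆ specClass d ρ S m :=
  Set.subset_iUnion (fun K => specClassDeg d ρ S K m) K

theorem IsAggregationGSO.notMoreExpressive_specClass {d : ℕ} {S : GSO.{u}}
    (hS : IsAggregationGSO S) (ρ : ℝ → ℝ) : NotMoreExpressive (specClass d ρ S) (wlSetoid d) :=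
  fun G H hGH m Φ hΦ =>
    let ⟨K, hK⟩ := Set.mem_iUnion.1 hΦ
    hS.notMoreExpressive ρ K G H hGH m Φ hK

theorem mainTheorem2 (d : ℕ) :
    (∀ (ρ : ℝ → ℝ) (S : GSO.{u}), IsAggregationGSO S →
        NotMoreExpressive (specClass d ρ S) (wlSetoid d)) ∧
      AsExpressive (specClass d relu adjGSO.{u}) (wlSetoid d) ∧
      (∀ K : ℕ, 1 ≤ K →
        AsExpressive (specClassDeg d relu adjGSO.{u} K) (wlSetoid d)) := by
  refine ⟨fun ρ S hS => hS.notMoreExpressive_specClass ρ, ⟨fun G H hGH => ?_,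
    isAggregationGSO_adjGSO.notMoreExpressive_specClass relu⟩, fun K hK =>
    ⟨notLessExpressive_specClassDeg_relu_adjGSO d hK,
      isAggregationGSO_adjGSO.notMoreExpressive relu K⟩⟩
  obtain ⟨m, Φ, hΦ, hne⟩ := notLessExpressive_specClassDeg_relu_adjGSO d le_rfl G H hGH
  exact ⟨m, Φ, specClassDeg_subset_specClass d relu adjGSO 1 m hΦ, hne⟩
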